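/- Let $q$ be a prime power. A $k$-space is a subspace of projective dimension $k$; lines, planes and solids are $1$-, $2$- and $3$-spaces. In $\mathrm{PG}(7,q)$ let $U_i$, $1\le i\le 8$, be the point with $1$ in the $i$-th position and $0$ elsewhere, and put $\Sigma'=\langle U_1,U_2,U_3,U_4\rangle$ and $\Sigma=\langle U_5,U_6,U_7,U_8\rangle$. Let the following be given. - A $(4\times 4,2)_q$ MRD-code $\mathcal A$, that is, a set of $q^{12}$ matrices of size $4\times4$ over $\mathrm{GF}(q)$ with minimum rank distance $2$. Let $\mathcal X=\{L(A) : A\in\mathcal A\}$, where $L(A)$ is the solid spanned by the rows of $(I_4\,|\,A)$. - $1$-parallelisms $\mathcal P$ of $\Sigma$ and $\mathcal P'$ of $\Sigma'$, and a bijection $\mu:\mathcal P'\to\mathcal P$. Here a line-spread of a solid is a set of $q^2+1$ of its lines such that each point of the solid lies on exactly one of them, and a $1$-parallelism of a solid is a collection of $q^2+q+1$ line-spreads such that each line of the solid belongs to exactly one of them. Let $\mathcal Z$ be the set of all solids $\Delta$ for which there are a line $\ell'$ of $\Sigma'$ and a line $\ell\in\mu(\mathcal S')$, where $\mathcal S'$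 is the line-spread of $\mathcal P'$ containing $\ell'$, such that $\Delta\subset\langle\Sigma,\ell'\rangle$ and $\Delta\cap\Sigma=\ell$. Then there exists a $5$-space $\Lambda$ of $\mathrm{PG}(7,q)$ containing exactly $q^4(q^2+1)+1$ members of $\mathcal X\cup\mathcal Z\cup\{\Sigma\}$ and such that every hyperplane of $\mathrm{PG}(7,q)$ through $\Lambda$ contains exactly $q^4(q^2+1)(q^2+q+1)+1$ members of $\mathcal X\cup\mathcal Z\cup\{\Sigma\}$. -/

import Mathlib

namespace QCovering

/-- The ambient vector space of `PG(n + m - 1, F)`; the first `n` coordinates are indexed by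
`Sum.inl`, the last `m` coordinates by `Sum.inr`. -/
abbrev Ambient (F : Type*) (n m : ℕ) : Type _ := Fin n ⊕ Fin m → F

/-- `S` is a `k`-space of the projective space of `V`: a subspace of projective dimension `k`,
that is, of vector space dimension `k + 1`. Points, lines, planes and solids are the cases
`k = 0, 1, 2, 3`. -/
def IsProjSpace {F V : Type*} [Field F] [AddCommGroup V] [Module F V]
    (k : ℕ) (S : Submodule F V) : Prop :=
  Module.finrank F S = k + 1

/-- An `(n × m, δ)_q` MRD-code, for `1 ≤ δ ≤ n ≤ m`: a set of `n × m` matrices whose minimum rank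
distance is `δ` and whose size is the largest possible one, `q ^ (m * (n - δ + 1))`. -/
structure IsMRDCode {F : Type*} [Field F] {n m : ℕ} (δ : ℕ)
    (C : Set (Matrix (Fin n) (Fin m) F)) : Prop where
  one_le : 1 ≤ δ
  le_rows : δ ≤ n
  rows_le_cols : n ≤ m
  minDist : IsLeast {d : ℕ | ∃ A ∈ C, ∃ B ∈ C, A ≠ B ∧ d = (A - B).rank} δ
  card_eq : C.ncard = Nat.card F ^ (m * (n - δ + 1))

/-- The lifting `L(A)` of a matrix `A`: the subspace spanned by the rows of `(I | A)`. -/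
def lift {F : Type*} [Field F] {n m : ℕ} (A : Matrix (Fin n) (Fin m) F) :
    Submodule F (Ambient F n m) :=
  Submodule.span F (Set.range (Matrix.fromCols (1 : Matrix (Fin n) (Fin n) F) A).row)

/-- The subspace spanned by the first `n` unit points. -/
def firstSpace (F : Type*) [Field F] (n m : ℕ) : Submodule F (Ambient F n m) :=
  Submodule.span F (Set.range fun i : Fin n => Pi.single (Sum.inl i) 1)

/-- The subspace spanned by the last `m` unit points. -/
def lastSpace (F : Type*) [Field F] (n m : ℕ) : Submodule F (Ambient F n m) :=
  Submodule.span F (Set.range fun j : Fin m => Pi.single (Sum.inr j) 1)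

/-- A line-spread of the solid `T`: a set of `q ^ 2 + 1` lines of `T` such that each point of `T`
is on exactly one of them. -/
structure IsLineSpread {F V : Type*} [Field F] [AddCommGroup V] [Module F V]
    (T : Submodule F V) (S : Set (Submodule F V)) : Prop where
  line : ∀ l ∈ S, IsProjSpace 1 l ∧ l ≤ T
  card_eq : S.ncard = Nat.card F ^ 2 + 1
  existsUnique : ∀ P : Submodule F V, IsProjSpace 0 P → P ≤ T → ∃! l, l ∈ S ∧ P ≤ l

/-- A `1`-parallelism of the solid `T`: a collection of `q ^ 2 + q + 1` line-spreads of `T` such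
that each line of `T` belongs to exactly one of them. -/
structure IsParallelism {F V : Type*} [Field F] [AddCommGroup V] [Module F V]
    (T : Submodule F V) (P : Set (Set (Submodule F V))) : Prop where
  spread : ∀ S ∈ P, IsLineSpread T S
  card_eq : P.ncard = Nat.card F ^ 2 + Nat.card F + 1
  existsUnique : ∀ l : Submodule F V, IsProjSpace 1 l → l ≤ T → ∃! S, S ∈ P ∧ l ∈ S

/-- The solids `L(A)`, for `A` in the code `C`. -/
def liftedSolids {F : Type*} [Field F] (C : Set (Matrix (Fin 4) (Fin 4) F)) :
    Set (Submodule F (Ambient F 4 4)) :=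
  lift '' C

/-- For a line `l'` of the first solid and a line `l` of the last solid: the solids of the
`5`-space spanned by `l'` and the last solid which meet the last solid exactly in `l`. -/
def solidsThrough {F : Type*} [Field F] (l' l : Submodule F (Ambient F 4 4)) :
    Set (Submodule F (Ambient F 4 4)) :=
  {D | IsProjSpace 3 D ∧ D ≤ lastSpace F 4 4 ⊔ l' ∧ D ⊓ lastSpace F 4 4 = l}

/-- The union of `solidsThrough l' l` over all lines `l'` of the first solid and all lines `l` of
the spread which `μ` assigns to the spread containing `l'`. -/
def parallelismSolids {F : Type*} [Field F] {P' P : Set (Set (Submodule F (Ambient F 4 4)))}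
    (μ : P' ≃ P) : Set (Submodule F (Ambient F 4 4)) :=
  {D | ∃ l' : Submodule F (Ambient F 4 4), IsProjSpace 1 l' ∧ l' ≤ firstSpace F 4 4 ∧
    ∃ S' : P', l' ∈ S'.1 ∧ ∃ l ∈ (μ S').1, D ∈ solidsThrough l' l}

/-- The collection of solids of `PG(7, q)` obtained from the code `C` and from the bijection `μ`
between parallelisms of the first and of the last solid. -/
def design {F : Type*} [Field F] (C : Set (Matrix (Fin 4) (Fin 4) F))
    {P' P : Set (Set (Submodule F (Ambient F 4 4)))} (μ : P' ≃ P) :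
    Set (Submodule F (Ambient F 4 4)) :=
  liftedSolids C ∪ parallelismSolids μ ∪ {lastSpace F 4 4}

end QCovering

/-! ### Counting subspaces of a vector space. -/

namespace Submodule

variable {F V : Type*} [Field F] [AddCommGroup V] [Module F V]

/-! Take `Λ = ⟨Σ, l'⟩` for any line `l'` of `Σ'`. A proper subspace `H` through `Σ` contains no
lifted solid, as each of these spans the whole space together with `Σ`. A solid of `solidsThrough l'
l` spans `⟨Σ, l'⟩` together with `Σ`, so it lies in `H` exactly when `l' ≤ H ⊓ Σ'`. Each such `l'`
is paired with the `q² + 1` lines `l` of a single spread, and each pair gives `q⁴` solids,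
parametrised by the linear maps from `l'` to a complement of `l` in `Σ` (`bijOn_supGraph`). Distinct
pairs share no solid, so with `Σ` itself `H` contains `q⁴(q² + 1)N + 1` solids, where `N` is the
number of lines of `H ⊓ Σ'` (`ncard_design_le`). This intersection is `l'` for `H = Λ`, and a plane
for a hyperplane `H`. -/

/-- The join of `l` with the graph of a linear map `φ : l' → m`. -/
def supGraph {l' m : Submodule F V} (l : Submodule F V) (φ : l' →ₗ[F] m) : Submodule F V :=
  l ⊔ LinearMap.range (l'.subtype + m.subtype ∘ₗ φ)

theorem mem_supGraph {l' m l : Submodule F V} {φ : l' →ₗ[F] m} {v : V} :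
    v ∈ supGraph l φ ↔ ∃ a ∈ l, ∃ x : l', a + (x + φ x) = v := by
  simp [supGraph, mem_sup]

/-- The subspaces which have the same join with `T` as `l'` and meet `T` in `l` correspond to the
linear maps from `l'` to a complement of `l` in `T`. -/
theorem bijOn_supGraph {T l' l m : Submodule F V} (hd : Disjoint T l') (hlm : Disjoint l m)
    (hT : l ⊔ m = T) :
    Set.BijOn (fun φ : l' →ₗ[F] m => supGraph l φ) Set.univ
      {D | D ⊔ T = T ⊔ l' ∧ D ⊓ T = l} := by
  have hl : l ≤ T := hT ▸ le_sup_left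
  have hm : m ≤ T := hT ▸ le_sup_right
  have maps (φ : l' →ₗ[F] m) : supGraph l φ ⊔ T = T ⊔ l' ∧ supGraph l φ ⊓ T = l := by
    refine ⟨le_antisymm (sup_le ?_ le_sup_left) (sup_le le_sup_right ?_), le_antisymm ?_ ?_⟩
    · intro v hv
      obtain ⟨a, ha, x, rfl⟩ := mem_supGraph.1 hv
      exact add_mem (mem_sup_left (hl ha))
        (add_mem (mem_sup_right x.2) (mem_sup_left (hm (φ x).2)))
    · intro x hx
      have h1 : x + φ ⟨x, hx⟩ ∈ supGraph l φ := mem_supGraph.2 ⟨0, zero_mem _, ⟨x, hx⟩, by simp⟩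
      have h2 := sub_mem (mem_sup_left (T := T) h1) (mem_sup_right (hm (φ ⟨x, hx⟩).2))
      simpa using h2
    · rintro v ⟨hv, hvT⟩
      obtain ⟨a, ha, x, rfl⟩ := mem_supGraph.1 hv
      have hx : (x : V) ∈ T := by
        have := sub_mem (sub_mem hvT (hl ha)) (hm (φ x).2)
        simpa using this
      have hx0 : x = 0 := Subtype.ext (disjoint_def.1 hd _ hx x.2)
      simpa [hx0] using ha
    · exact le_inf le_sup_left hl
  refine ⟨fun φ _ => maps φ, fun φ _ ψ _ h => ?_, fun D hD => ?_⟩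
  -- Injectivity: the components in `l'`, `l` and `m` of a vector are unique.
  · ext x
    have h1 : (x : V) + φ x ∈ supGraph l ψ := by
      rw [← show supGraph l φ = supGraph l ψ from h]
      exact mem_supGraph.2 ⟨0, zero_mem _, x, by simp⟩
    obtain ⟨a, ha, y, hy⟩ := mem_supGraph.1 h1
    have hxy : x = y := by
      rw [← sub_eq_zero]
      refine Subtype.ext (disjoint_def.1 hd _ ?_ (x - y).2)
      have : ((x - y : l') : V) = a + ψ y - φ x := by
        rw [AddSubgroupClass.coe_sub, sub_eq_sub_iff_add_eq_add, ← hy]; abel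
      rw [this]
      exact sub_mem (add_mem (hl ha) (hm (ψ y).2)) (hm (φ x).2)
    subst hxy
    have h2 : a = ((φ x - ψ x : m) : V) := by
      rw [AddSubgroupClass.coe_sub, eq_sub_iff_add_eq]
      exact add_left_cancel (a := (x : V)) (by rw [← hy]; abel)
    have h3 := disjoint_def.1 hlm a ha (h2 ▸ (φ x - ψ x).2)
    rw [h3, AddSubgroupClass.coe_sub, eq_comm, sub_eq_zero] at h2
    exact h2
  · obtain ⟨hsup, hinf⟩ := hD
    -- Surjectivity: `D ⊔ T = D ⊔ m` moves each `x` into `D` by an element of `m`, which is unique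
    -- because `D ⊓ m ≤ l ⊓ m = ⊥`. Uniqueness makes the choice linear.
    have ex (x : l') : ∃ b : m, (x : V) + b ∈ D := by
      have hx : (x : V) ∈ D ⊔ T := hsup ▸ mem_sup_right x.2
      rw [← hT, ← sup_assoc, sup_eq_left.2 (hinf ▸ inf_le_left : l ≤ D)] at hx
      obtain ⟨d, hd, b, hb, h⟩ := mem_sup.1 hx
      exact ⟨-⟨b, hb⟩, by simpa [← h] using hd⟩
    have uniq (x : V) (b c : m) (hb : x + b ∈ D) (hc : x + c ∈ D) : b = c := by
      rw [← sub_eq_zero]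
      refine Subtype.ext (disjoint_def.1 hlm _ (hinf ▸ ⟨?_, hm (b - c).2⟩) (b - c).2)
      simpa using sub_mem hb hc
    choose f hf using ex
    let φ : l' →ₗ[F] m :=
      { toFun := f
        map_add' := fun x y => uniq (x + y : l') _ _ (hf _) (by
          have := add_mem (hf x) (hf y)
          rwa [add_add_add_comm] at this)
        map_smul' := fun c x => uniq (c • x : l') _ _ (hf _) (by
          simpa using smul_mem _ c (hf x)) }
    -- By modularity, nested subspaces with the same meet and join with `T` coincide.
    refine ⟨φ, Set.mem_univ _, eq_of_le_of_inf_le_of_sup_le (z := T) ?_ ?_ ?_⟩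
    · intro v hv
      obtain ⟨a, ha, x, rfl⟩ := mem_supGraph.1 hv
      exact add_mem ((hinf ▸ inf_le_left : l ≤ D) ha) (hf x)
    · exact (hinf.trans (maps φ).2.symm).le
    · exact (hsup.trans (maps φ).1.symm).le

theorem ncard_sup_eq_inf_eq [FiniteDimensional F V] {T l' l : Submodule F V}
    (hd : Disjoint T l') (hl : l ≤ T) :
    {D : Submodule F V | D ⊔ T = T ⊔ l' ∧ D ⊓ T = l}.ncard =
      Nat.card F ^ (Module.finrank F l' * (Module.finrank F T - Module.finrank F l)) := by
  obtain ⟨m, hlm, hT⟩ := IsModularLattice.exists_disjoint_and_sup_eq hl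
  have hb := bijOn_supGraph hd hlm hT
  have hdim := finrank_sup_add_finrank_inf_eq l m
  rw [hT, hlm.eq_bot, finrank_bot, add_zero] at hdim
  rw [← hb.image_eq, hb.injOn.ncard_image, Set.ncard_univ,
    Module.natCard_eq_pow_finrank (K := F), Module.finrank_linearMap, hdim,
    Nat.add_sub_cancel_left]

/-- The number of `n`-dimensional subspaces contained in an `n + 1`-dimensional space. -/
theorem ncard_hyperplanes_le [Finite F] [FiniteDimensional F V] {n : ℕ} {W : Submodule F V}
    (hW : Module.finrank F W = n + 1) :
    {l : Submodule F V | Module.finrank F l = n ∧ l ≤ W}.ncard =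
      ∑ i ∈ Finset.range (n + 1), Nat.card F ^ i := by
  -- Annihilators turn the hyperplanes of `W` into the points of its dual.
  rw [← Projectivization.card_of_finrank F (Module.Dual F W) (Subspace.dual_finrank_eq.trans hW),
    Nat.card_congr (Projectivization.equivSubmodule F (Module.Dual F W)), ← Nat.card_coe_set_eq]
  refine Nat.card_congr (Equiv.trans ?_
    ((Subspace.orderIsoFiniteDimensional (K := F) (V := W)).toEquiv.trans
      OrderDual.ofDual |>.subtypeEquiv (p := fun l : Submodule F W => Module.finrank F l = n) fun l => ?_))
  · refine ((Equiv.subtypeEquivRight fun l => and_comm).trans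
      (Equiv.subtypeSubtypeEquivSubtypeInter (fun l => l ≤ W) _).symm).trans
      (W.mapIic.toEquiv.subtypeEquiv fun l => ?_).symm
    exact iff_of_eq (congrArg (· = n) (LinearEquiv.finrank_eq
      (equivMapOfInjective W.subtype W.injective_subtype l)))
  · have := Subspace.finrank_add_finrank_dualAnnihilator_eq l
    change _ ↔ Module.finrank F l.dualAnnihilator = 1
    lia

end Submodule

namespace QCovering

open Submodule Module

/-! ### The decomposition into first and last space. -/

section Coordinates

variable {F : Type*} [Field F] {n m : ℕ}

theorem linearIndependent_single :
    LinearIndependent F fun i : Fin n ⊕ Fin m => (Pi.single i 1 : Ambient F n m) := by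
  convert (Pi.basisFun F (Fin n ⊕ Fin m)).linearIndependent using 2
  exact (Pi.basisFun_apply ..).symm

theorem finrank_firstSpace : finrank F (firstSpace F n m) = n := by
  have := finrank_span_eq_card
    ((linearIndependent_single (F := F) (n := n) (m := m)).comp _ Sum.inl_injective)
  rwa [Fintype.card_fin] at this

theorem finrank_lastSpace : finrank F (lastSpace F n m) = m := by
  have := finrank_span_eq_card
    ((linearIndependent_single (F := F) (n := n) (m := m)).comp _ Sum.inr_injective)
  rwa [Fintype.card_fin] at this

theorem firstSpace_sup_lastSpace : firstSpace F n m ⊔ lastSpace F n m = ⊤ := by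
  have := (Pi.basisFun F (Fin n ⊕ Fin m)).span_eq
  rw [firstSpace, lastSpace, ← span_union, ← this]
  congr 1
  ext v
  simp [Sum.exists]

theorem isCompl_lastSpace_firstSpace : IsCompl (lastSpace F n m) (firstSpace F n m) := by
  refine ⟨?_, codisjoint_iff.2 (sup_comm (lastSpace F n m) _ ▸ firstSpace_sup_lastSpace)⟩
  have h := finrank_sup_add_finrank_inf_eq (lastSpace F n m) (firstSpace F n m)
  rw [sup_comm, firstSpace_sup_lastSpace, finrank_lastSpace, finrank_firstSpace, finrank_top,
    finrank_fintype_fun_eq_card, Fintype.card_sum, Fintype.card_fin, Fintype.card_fin] at h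
  rw [disjoint_iff, ← finrank_eq_zero (R := F)]
  lia

/-- A lifted subspace together with the last space spans everything. -/
theorem lift_sup_lastSpace (A : Matrix (Fin n) (Fin m) F) : lift A ⊔ lastSpace F n m = ⊤ := by
  rw [eq_top_iff, ← firstSpace_sup_lastSpace]
  refine sup_le (span_le.2 ?_) le_sup_right
  rintro _ ⟨i, rfl⟩
  have h1 : (Matrix.fromCols (1 : Matrix (Fin n) (Fin n) F) A).row i ∈ lift A :=
    subset_span ⟨i, rfl⟩
  have h2 : ∑ j, A i j • (Pi.single (Sum.inr j) 1 : Ambient F n m) ∈ lastSpace F n m :=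
    sum_mem fun j _ => smul_mem _ _ (subset_span ⟨j, rfl⟩)
  have h3 : (Pi.single (Sum.inl i) 1 : Ambient F n m) =
      (Matrix.fromCols (1 : Matrix (Fin n) (Fin n) F) A).row i -
        ∑ j, A i j • (Pi.single (Sum.inr j) 1 : Ambient F n m) := ?_
  · change Pi.single (Sum.inl i) 1 ∈ lift A ⊔ lastSpace F n m
    rw [h3]
    exact sub_mem (mem_sup_left (T := lastSpace F n m) h1) (mem_sup_right h2)
  ext (j | j)
  · simp [Matrix.row, Matrix.one_apply, Pi.single_apply, eq_comm]
  · simp [Matrix.row, Pi.single_apply]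

end Coordinates

/-! ### Counting the solids of the design. -/

variable {F : Type*} [Field F]

/-- The join of `l'` with the last space has dimension 6. Once `D` meets the last space in a line,
the dimension formula makes `finrank D = 4` equivalent to the join of `D` with the last space having
dimension 6. This brings `solidsThrough` into the form of `bijOn_supGraph`. -/
theorem mem_solidsThrough_iff {l' l : Submodule F (Ambient F 4 4)} (hl' : IsProjSpace 1 l')
    (hl'T : l' ≤ firstSpace F 4 4) (hl : IsProjSpace 1 l) {D : Submodule F (Ambient F 4 4)} :
    D ∈ solidsThrough l' l ↔
      D ⊔ lastSpace F 4 4 = lastSpace F 4 4 ⊔ l' ∧ D ⊓ lastSpace F 4 4 = l := by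
  have hd : Disjoint (lastSpace F 4 4) l' := isCompl_lastSpace_firstSpace.disjoint.mono_right hl'T
  have h1 := finrank_sup_add_finrank_inf_eq (lastSpace F 4 4) l'
  have h2 := finrank_sup_add_finrank_inf_eq D (lastSpace F 4 4)
  rw [hd.eq_bot, finrank_bot] at h1
  have hT : finrank F (lastSpace F 4 4) = 4 := finrank_lastSpace
  simp only [IsProjSpace] at hl hl'
  constructor
  · rintro ⟨hD, hle, rfl⟩
    simp only [IsProjSpace] at hD
    exact ⟨eq_of_le_of_finrank_eq (sup_le hle le_sup_left) (by lia), rfl⟩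
  · rintro ⟨hsup, rfl⟩
    rw [hsup] at h2
    exact ⟨show finrank F D = 3 + 1 by lia, hsup ▸ le_sup_left, rfl⟩

/-- The trace on the first space recovers the line `l'` from a member of `solidsThrough l' l`. -/
theorem sup_lastSpace_inf_firstSpace {l' : Submodule F (Ambient F 4 4)}
    (hl'T : l' ≤ firstSpace F 4 4) :
    (lastSpace F 4 4 ⊔ l') ⊓ firstSpace F 4 4 = l' := by
  rw [sup_comm, sup_inf_assoc_of_le _ hl'T, isCompl_lastSpace_firstSpace.inf_eq_bot, sup_bot_eq]

/-- Both lines are recovered from a solid: `l` as its trace on the last space, `l'` from its join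
with the last space. -/
theorem solidsThrough_disjoint {l₁' l₂' l₁ l₂ : Submodule F (Ambient F 4 4)}
    (hl₁' : IsProjSpace 1 l₁') (h₁T : l₁' ≤ firstSpace F 4 4) (hl₁ : IsProjSpace 1 l₁)
    (hl₂' : IsProjSpace 1 l₂') (h₂T : l₂' ≤ firstSpace F 4 4) (hl₂ : IsProjSpace 1 l₂)
    (hne : l₁' ≠ l₂' ∨ l₁ ≠ l₂) :
    Disjoint (solidsThrough l₁' l₁) (solidsThrough l₂' l₂) := by
  refine Set.disjoint_left.2 fun D h1 h2 => ?_
  rw [mem_solidsThrough_iff hl₁' h₁T hl₁] at h1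
  rw [mem_solidsThrough_iff hl₂' h₂T hl₂] at h2
  refine hne.elim (fun h => h ?_) fun h => h (h1.2.symm.trans h2.2)
  rw [← sup_lastSpace_inf_firstSpace h₁T, ← h1.1, h2.1, sup_lastSpace_inf_firstSpace h₂T]

theorem ncard_solidsThrough {l' l : Submodule F (Ambient F 4 4)} (hl' : IsProjSpace 1 l')
    (hl'T : l' ≤ firstSpace F 4 4) (hl : IsProjSpace 1 l) (hlT : l ≤ lastSpace F 4 4) :
    (solidsThrough l' l).ncard = Nat.card F ^ 4 := by
  have h := ncard_sup_eq_inf_eq (isCompl_lastSpace_firstSpace.disjoint.mono_right hl'T) hlT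
  rw [hl', hl, finrank_lastSpace] at h
  rw [← h]
  congr 1
  ext D
  exact mem_solidsThrough_iff hl' hl'T hl

theorem ncard_biUnion_const {ι α : Type*} [Finite ι] [Finite α] {s : Set ι} {f : ι → Set α}
    {k : ℕ} (hf : ∀ i ∈ s, (f i).ncard = k) (hd : s.PairwiseDisjoint f) :
    (⋃ i ∈ s, f i).ncard = k * s.ncard := by
  rw [s.toFinite.ncard_biUnion (fun i _ => (f i).toFinite) hd, finsum_mem_congr rfl hf,
    finsum_mem_eq_finite_toFinset_sum _ s.toFinite, Finset.sum_const, smul_eq_mul, mul_comm,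
    Set.ncard_eq_toFinset_card s]

/-- The solids of the design in a proper subspace `H` through the last solid, counted by the lines
which `H` has in common with the first solid. -/
theorem ncard_design_le [Finite F] (C : Set (Matrix (Fin 4) (Fin 4) F))
    {P P' : Set (Set (Submodule F (Ambient F 4 4)))}
    (hP : IsParallelism (lastSpace F 4 4) P) (hP' : IsParallelism (firstSpace F 4 4) P')
    (μ : P' ≃ P) {H : Submodule F (Ambient F 4 4)} (hT : lastSpace F 4 4 ≤ H) (hH : H ≠ ⊤) :
    {D | D ∈ design C μ ∧ D ≤ H}.ncard = Nat.card F ^ 4 * (Nat.card F ^ 2 + 1) *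
      {l' : Submodule F (Ambient F 4 4) | finrank F l' = 2 ∧ l' ≤ H ⊓ firstSpace F 4 4}.ncard + 1 := by
  -- `R l'` is the spread that `μ` assigns to the one containing `l'`; the value `∅` is a default
  -- for subspaces that are not lines of the first space.
  have ex (l' : Submodule F (Ambient F 4 4)) :
      ∃ R : Set (Submodule F (Ambient F 4 4)), IsProjSpace 1 l' → l' ≤ firstSpace F 4 4 →
        IsLineSpread (lastSpace F 4 4) R ∧ ∀ S' : P', l' ∈ S'.1 ↔ (μ S').1 = R := by
    by_cases h : IsProjSpace 1 l' ∧ l' ≤ firstSpace F 4 4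
    · obtain ⟨S, ⟨hS, hl⟩, hu⟩ := hP'.existsUnique l' h.1 h.2
      refine ⟨(μ ⟨S, hS⟩).1, fun _ _ => ⟨hP.spread _ (μ ⟨S, hS⟩).2, fun S' => ?_⟩⟩
      rw [Subtype.val_inj, μ.apply_eq_iff_eq]
      exact ⟨fun h => Subtype.ext (hu S'.1 ⟨S'.2, h⟩), fun h => h ▸ hl⟩
    · exact ⟨∅, fun h1 h2 => (h ⟨h1, h2⟩).elim⟩
  choose R hR using ex
  have key : {D | D ∈ design C μ ∧ D ≤ H} = insert (lastSpace F 4 4)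
      (⋃ l' ∈ {l' : Submodule F (Ambient F 4 4) | finrank F l' = 2 ∧ l' ≤ H ⊓ firstSpace F 4 4},
        ⋃ l ∈ R l', solidsThrough l' l) := by
    ext D
    simp only [design, liftedSolids, parallelismSolids, Set.mem_ofPred_eq, Set.mem_union,
      Set.mem_singleton_iff, Set.mem_insert_iff, Set.mem_iUnion, exists_prop]
    constructor
    · rintro ⟨((⟨A, -, rfl⟩ | ⟨l', hl', hl'T, S', hS', l, hl, hD⟩) | rfl), hDH⟩
      · exact absurd (eq_top_iff.2 (lift_sup_lastSpace A ▸ sup_le hDH hT)) hH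
      · have h := hR l' hl' hl'T
        rw [(h.2 S').1 hS'] at hl
        have hD' := (mem_solidsThrough_iff hl' hl'T (h.1.line l hl).1).1 hD
        exact .inr ⟨l', ⟨hl', le_inf (le_sup_right.trans (hD'.1.ge.trans (sup_le hDH hT))) hl'T⟩,
          l, hl, hD⟩
      · exact .inl rfl
    · rintro (rfl | ⟨l', ⟨hl', hl'H⟩, l, hl, hD⟩)
      · exact ⟨.inr rfl, hT⟩
      · obtain ⟨hl'H, hl'T⟩ := le_inf_iff.1 hl'H
        have h := hR l' hl' hl'T
        obtain ⟨S, ⟨hS, hlS⟩, -⟩ := hP'.existsUnique l' hl' hl'T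
        refine ⟨.inl (.inr ⟨l', hl', hl'T, ⟨S, hS⟩, hlS, l, ?_, hD⟩),
          hD.2.1.trans (sup_le hT hl'H)⟩
        rwa [(h.2 ⟨S, hS⟩).1 hlS]
  rw [key, Set.ncard_insert_of_notMem _ (Set.toFinite _), ncard_biUnion_const]
  · rintro l' ⟨hl', hl'H⟩
    have h := (hR l' hl' (le_inf_iff.1 hl'H).2).1
    rw [← h.card_eq]
    refine ncard_biUnion_const (fun l hl => ncard_solidsThrough hl' (le_inf_iff.1 hl'H).2
      (h.line l hl).1 (h.line l hl).2) fun l₁ h₁ l₂ h₂ hne => ?_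
    exact solidsThrough_disjoint hl' (le_inf_iff.1 hl'H).2 (h.line l₁ h₁).1 hl'
      (le_inf_iff.1 hl'H).2 (h.line l₂ h₂).1 (.inr hne)
  · intro l₁' h₁ l₂' h₂ hne
    have h₁T := (le_inf_iff.1 h₁.2).2
    have h₂T := (le_inf_iff.1 h₂.2).2
    simp only [Function.onFun, Set.disjoint_iUnion_left, Set.disjoint_iUnion_right]
    intro l₂ hl₂ l₁ hl₁
    exact solidsThrough_disjoint h₁.1 h₁T ((hR _ h₁.1 h₁T).1.line _ hl₁).1 h₂.1 h₂T
      ((hR _ h₂.1 h₂T).1.line _ hl₂).1 (.inl hne)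
  -- The last space meets itself in dimension 4, not in a line, so it is counted separately.
  · simp only [Set.mem_iUnion, not_exists]
    rintro l' ⟨hl', hl'H⟩ l hl hD
    have h := ((hR l' hl' (le_inf_iff.1 hl'H).2).1.line l hl).1
    have h2 := hD.2.2
    rw [inf_idem] at h2
    rw [← h2, IsProjSpace, finrank_lastSpace] at h
    exact absurd h (by norm_num)

/-- Since `H` contains the last space, its join with the first space is everything, and the
dimension formula applies. -/
theorem finrank_inf_firstSpace {n m : ℕ} {H : Submodule F (Ambient F n m)}
    (hT : lastSpace F n m ≤ H) : finrank F (H ⊓ firstSpace F n m : Submodule F _) + m =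
      finrank F H := by
  have h := finrank_sup_add_finrank_inf_eq H (firstSpace F n m)
  have hs : H ⊔ firstSpace F n m = ⊤ := by
    rw [sup_comm, eq_top_iff, ← firstSpace_sup_lastSpace]
    exact sup_le_sup_left hT _
  rw [hs, finrank_top, finrank_fintype_fun_eq_card, Fintype.card_sum, Fintype.card_fin,
    Fintype.card_fin, finrank_firstSpace] at h
  lia

theorem exists_line_le_firstSpace :
    ∃ l' : Submodule F (Ambient F 4 4), IsProjSpace 1 l' ∧ l' ≤ firstSpace F 4 4 := by
  obtain ⟨f, hf⟩ : ∃ f : Fin 2 → Fin 4, Function.Injective f := ⟨_, Fin.castLE_injective (by simp)⟩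
  refine ⟨span F (Set.range fun i => Pi.single (Sum.inl (f i)) 1), ?_,
    span_mono (Set.range_subset_iff.2 fun i => ⟨f i, rfl⟩)⟩
  have := finrank_span_eq_card
    ((linearIndependent_single (F := F) (n := 4) (m := 4)).comp _ (Sum.inl_injective.comp hf))
  rwa [Fintype.card_fin] at this

end QCovering

theorem proposition5p3 {F : Type*} [Field F] [Finite F] (q : ℕ) (hq : Nat.card F = q)
    (C : Set (Matrix (Fin 4) (Fin 4) F)) (hC : QCovering.IsMRDCode 2 C)
    (P P' : Set (Set (Submodule F (QCovering.Ambient F 4 4))))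
    (hP : QCovering.IsParallelism (QCovering.lastSpace F 4 4) P)
    (hP' : QCovering.IsParallelism (QCovering.firstSpace F 4 4) P')
    (μ : P' ≃ P) :
    ∃ L : Submodule F (QCovering.Ambient F 4 4), QCovering.IsProjSpace 5 L ∧
      {D | D ∈ QCovering.design C μ ∧ D ≤ L}.ncard = q ^ 4 * (q ^ 2 + 1) + 1 ∧
      ∀ H : Submodule F (QCovering.Ambient F 4 4), QCovering.IsProjSpace 6 H → L ≤ H →
        {D | D ∈ QCovering.design C μ ∧ D ≤ H}.ncard =
          q ^ 4 * (q ^ 2 + 1) * (q ^ 2 + q + 1) + 1 := by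
  subst hq
  have ne_top {H : Submodule F (QCovering.Ambient F 4 4)} (h : Module.finrank F H < 8) :
      H ≠ ⊤ := by
    rintro rfl
    simp at h
  obtain ⟨l', hl', hl'T⟩ := QCovering.exists_line_le_firstSpace (F := F)
  have hL : Module.finrank F (QCovering.lastSpace F 4 4 ⊔ l' : Submodule F _) = 6 := by
    have h := QCovering.finrank_inf_firstSpace (le_sup_left : _ ≤ QCovering.lastSpace F 4 4 ⊔ l')
    rw [QCovering.sup_lastSpace_inf_firstSpace hl'T, hl'] at h
    exact h.symm
  refine ⟨QCovering.lastSpace F 4 4 ⊔ l', hL, ?_, fun H hH hLH => ?_⟩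
  · rw [QCovering.ncard_design_le C hP hP' μ le_sup_left (ne_top (by lia)),
      QCovering.sup_lastSpace_inf_firstSpace hl'T]
    have h : {m : Submodule F (QCovering.Ambient F 4 4) | Module.finrank F m = 2 ∧ m ≤ l'} = {l'} := by
      ext m
      refine ⟨fun h => Submodule.eq_of_le_of_finrank_eq h.2 (h.1.trans hl'.symm), ?_⟩
      rintro rfl
      exact ⟨hl', le_rfl⟩
    rw [h, Set.ncard_singleton, mul_one]
  · have hTH := le_sup_left.trans hLH
    have h := QCovering.finrank_inf_firstSpace hTH
    rw [hH] at h
    -- The dimension is `7 - 4 = 3`, so the lines of this intersection are its hyperplanes.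
    replace h : Module.finrank F (H ⊓ QCovering.firstSpace F 4 4 : Submodule F _) = 2 + 1 := by lia
    rw [QCovering.ncard_design_le C hP hP' μ hTH (ne_top (hH.trans_lt (by simp))),
      Submodule.ncard_hyperplanes_le h]
    simp only [Finset.sum_range_succ, Finset.sum_range_zero]
    ring
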